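/- Let $\mathbb{D}$ be the open unit disc in $\mathbb{C}$, let $\sigma$ be normalized arc length on $\partial\mathbb{D}$, and let $1\le p<\infty$. Let $H^p$ be the space of analytic functions $f$ on $\mathbb{D}$ with $$\|f\|_{H^p}^p=\sup_{0<r<1}\frac1{2\pi}\int_0^{2\pi}|f(re^{i\theta})|^p\,d\theta<\infty,$$ and let $S_2^p$ be the space of analytic functions $f$ on $\mathbb{D}$ with $f''\in H^p$, normed by $\|f\|_{S_2^p}=|f(0)|+|f'(0)|+\|f''\|_{H^p}$. For an analytic function $u$ on $\mathbb{D}$ let $M_u f=uf$. Let $\psi$ be analytic on $\mathbb{D}$. Then the following are equivalent: (a) $M_\psi$ is a bounded operator from $S_2^p$ to $S_2^p$. (b) $\psi\in S_2^p$, and $M_{2\psi'}$ and $M_\psi$ are bounded operators from $H^p$ to $H^p$. (c) $\psi\in S_2^p$ and $$\sup_{a\in\mathbb{D}}\int_{\partial\mathbb{D}}\frac{1-|a|^2}{|1-\overline{a}w|^2}\,|2\psi'(w)|^p\,d\sigma(w)<\infty,\qquad \sup_{a\in\mathbb{D}}\int_{\partial\mathbb{D}}\frac{1-|a|^2}{|1-\overline{a}w|^2}\,|\psi(w)|^p\,d\sigma(w)<\infty,$$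 where on $\partial\mathbb{D}$ the symbols $\psi$ and $\psi'$ denote the radial limit functions $w\mapsto\lim_{r\to1^-}\psi(rw)$ and $w\mapsto\lim_{r\to1^-}\psi'(rw)$, which exist $\sigma$-almost everywhere when $\psi\in S_2^p$. -/

import Mathlib

open scoped ENNReal Topology

noncomputable section

namespace HardyMult

/-- The open unit disc. Functions on the disc are represented by functions `ℂ → ℂ`; every notion
below depends only on their values on the disc. -/
def disc : Set ℂ := Metric.ball (0 : ℂ) 1

/-- The mean `(1 / 2π) ∫_0^{2π} g (r e^{iθ}) dθ` of a `[0, ∞]`-valued function on the circle of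
radius `r`. For `r = 1` it is the integral against normalized arc length on the unit circle. -/
def circleMean (g : ℂ → ℝ≥0∞) (r : ℝ) : ℝ≥0∞ :=
  (ENNReal.ofReal (2 * Real.pi))⁻¹ *
    ∫⁻ θ in Set.Ioc (0 : ℝ) (2 * Real.pi), g (circleMap 0 r θ)

/-- `sup_{0 < r < 1} (1 / 2π) ∫_0^{2π} |f (r e^{iθ})|^p dθ`, the `p`-th power of the Hardy norm,
with values in `[0, ∞]`. -/
def hardySup (p : ℝ) (f : ℂ → ℂ) : ℝ≥0∞ :=
  ⨆ r ∈ Set.Ioo (0 : ℝ) 1, circleMean (fun z => ‖f z‖ₑ ^ p) r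

/-- The Hardy space `H^p`. -/
def Hardy (p : ℝ) : Set (ℂ → ℂ) :=
  {f | DifferentiableOn ℂ f disc ∧ hardySup p f < ∞}

/-- The norm of `H^p` (meaningful on `Hardy p`). -/
def hardyNorm (p : ℝ) (f : ℂ → ℂ) : ℝ := (hardySup p f).toReal ^ (1 / p)

/-- The space `S_2^p` of analytic functions on the disc with second derivative in `H^p`. -/
def S2 (p : ℝ) : Set (ℂ → ℂ) :=
  {f | DifferentiableOn ℂ f disc ∧ deriv (deriv f) ∈ Hardy p}

/-- The norm `|f(0)| + |f'(0)| + ‖f''‖_{H^p}` of `S_2^p` (meaningful on `S2 p`). -/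
def S2Norm (p : ℝ) (f : ℂ → ℂ) : ℝ :=
  ‖f 0‖ + ‖deriv f 0‖ + hardyNorm p (deriv (deriv f))

/-- The multiplication operator `M_ψ`. -/
def mulOp (ψ : ℂ → ℂ) (f : ℂ → ℂ) : ℂ → ℂ := fun z => ψ z * f z

/-- `T` is a bounded operator from the space `X` with norm `N` into itself. -/
def IsBoundedOp (X : Set (ℂ → ℂ)) (N : (ℂ → ℂ) → ℝ) (T : (ℂ → ℂ) → ℂ → ℂ) : Prop :=
  (∀ f ∈ X, T f ∈ X) ∧ ∃ C : ℝ, ∀ f ∈ X, N (T f) ≤ C * N f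

/-- The boundary function `w ↦ lim_{r → 1⁻} f (r w)`, `|w| = 1` (radial limits). -/
def boundaryValue (f : ℂ → ℂ) (w : ℂ) : ℂ :=
  Filter.limUnder (𝓝[<] (1 : ℝ)) fun r : ℝ => f ((r : ℂ) * w)

/-- `sup_{a ∈ 𝔻} ∫_{∂𝔻} (1 - |a|²) / |1 - conj a * w|² |f(w)|^p dσ(w)`, where `f` on the circle
means the boundary function. -/
def poissonSup (p : ℝ) (f : ℂ → ℂ) : ℝ≥0∞ :=
  ⨆ a ∈ disc, circleMean (fun w =>
    ENNReal.ofReal ((1 - ‖a‖ ^ 2) / ‖1 - (starRingEnd ℂ) a * w‖ ^ 2) *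
      ‖boundaryValue f w‖ₑ ^ p) 1

end HardyMult

end

/-!
Functions whose derivative lies in `H^1` are bounded: on the circle `|z| = r` such a function
oscillates by at most `∫ |g'(re^{iθ})| dθ`, and the maximum principle compares its values on the
circle with `g 0`. They also have radial limits almost everywhere, since by Tonelli almost every
radius is mapped to a curve of finite length. Hence for `ψ ∈ S_2^p` both `ψ` and `ψ'` are bounded
with radial limits, and as the Poisson kernel has mean one, the conditions on `M_{2ψ'}`, on `M_ψ`
and on the Poisson integrals hold automatically. In the Leibniz formula
`(ψ f)'' = ψ'' f + 2 ψ' f' + ψ f''` every summand is the product of a bounded function and an `H^p`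
function, so `S_2^p` is an algebra; conversely a multiplier `ψ` of `S_2^p` is `M_ψ 1 ∈ S_2^p`.
All three conditions thus say that `ψ ∈ S_2^p`.
-/

namespace HardyMult

open MeasureTheory ProbabilityTheory Set Filter

open scoped Real

variable {E F : Type*} [NormedAddCommGroup E] [NormedAddCommGroup F]

lemma isOpen_disc : IsOpen disc := Metric.isOpen_ball

lemma mem_disc {z : ℂ} : z ∈ disc ↔ ‖z‖ < 1 := mem_ball_zero_iff

lemma zero_mem_disc : (0 : ℂ) ∈ disc := Metric.mem_ball_self one_pos

lemma circleMap_mem_disc {r : ℝ} (hr : |r| < 1) (θ : ℝ) : circleMap 0 r θ ∈ disc := by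
  rwa [mem_disc, norm_circleMap_zero]

lemma ofReal_mul_circleMap_one (r θ : ℝ) : (r : ℂ) * circleMap 0 1 θ = circleMap 0 r θ := by
  simp only [circleMap, zero_add, Complex.ofReal_one, one_mul]

lemma hasDerivAt_of_mem_disc [NormedSpace ℂ E] {g : ℂ → E} (hg : DifferentiableOn ℂ g disc)
    {z : ℂ} (hz : z ∈ disc) : HasDerivAt g (deriv g z) z :=
  (hg.differentiableAt (isOpen_disc.mem_nhds hz)).hasDerivAt

/-- Normalized Lebesgue measure on the parameter interval `(0, 2π]` of the circle, so that
`circleMean` is an integral against a probability measure. -/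
noncomputable def circleMeasure : Measure ℝ := volume[|Ioc 0 (2 * π)]

instance : IsProbabilityMeasure circleMeasure :=
  cond_isProbabilityMeasure_of_finite (by simp [Real.volume_Ioc, Real.pi_pos])
    measure_Ioc_lt_top.ne

lemma circleMean_eq_lintegral (g : ℂ → ℝ≥0∞) (r : ℝ) :
    circleMean g r = ∫⁻ θ, g (circleMap 0 r θ) ∂circleMeasure := by
  simp [circleMean, circleMeasure, ProbabilityTheory.cond, lintegral_smul_measure]

lemma setLIntegral_Ioc_eq_mul_lintegral_circleMeasure (g : ℝ → ℝ≥0∞) :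
    ∫⁻ θ in Ioc 0 (2 * π), g θ = ENNReal.ofReal (2 * π) * ∫⁻ θ, g θ ∂circleMeasure := by
  have hpi : ENNReal.ofReal (2 * π) ≠ 0 := by simpa using Real.pi_pos
  rw [circleMeasure, ProbabilityTheory.cond, lintegral_smul_measure, Real.volume_Ioc, sub_zero,
    smul_eq_mul, ENNReal.mul_inv_cancel_left hpi ENNReal.ofReal_ne_top]

/-- The integral mean `M_p(r, f)` of Hardy space theory: the `L^p` norm of `f` on the circle of
radius `r`, with values in `[0, ∞]`. -/
noncomputable def integralMean (p : ℝ≥0∞) (f : ℂ → E) (r : ℝ) : ℝ≥0∞ :=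
  eLpNorm (fun θ => f (circleMap 0 r θ)) p circleMeasure

/-- The Hardy norm `sup_{0 < r < 1} M_p(r, f)` with values in `[0, ∞]`, for which the norm
inequalities need no membership hypotheses. The exponent `p = ∞` is allowed. -/
noncomputable def eHardyNorm (p : ℝ≥0∞) (f : ℂ → E) : ℝ≥0∞ :=
  ⨆ r ∈ Ioo (0 : ℝ) 1, integralMean p f r

section eHardyNorm

variable {p q : ℝ≥0∞} {f g : ℂ → E}

lemma integralMean_one (f : ℂ → E) (r : ℝ) :
    integralMean 1 f r = ∫⁻ θ, ‖f (circleMap 0 r θ)‖ₑ ∂circleMeasure :=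
  eLpNorm_one_eq_lintegral_enorm

lemma integralMean_le_eHardyNorm {r : ℝ} (hr : r ∈ Ioo (0 : ℝ) 1) :
    integralMean p f r ≤ eHardyNorm p f :=
  le_iSup₂ (f := fun r _ => integralMean p f r) r hr

lemma circleMap_mem_disc_of_mem_Ioo {r : ℝ} (hr : r ∈ Ioo (0 : ℝ) 1) (θ : ℝ) :
    circleMap 0 r θ ∈ disc :=
  circleMap_mem_disc ((abs_of_pos hr.1).trans_lt hr.2) θ

lemma aestronglyMeasurable_comp_circleMap (hf : ContinuousOn f disc) {r : ℝ}
    (hr : r ∈ Ioo (0 : ℝ) 1) :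
    AEStronglyMeasurable (fun θ => f (circleMap 0 r θ)) circleMeasure :=
  (hf.comp_continuous (continuous_circleMap 0 r)
    (circleMap_mem_disc_of_mem_Ioo hr)).aestronglyMeasurable

lemma eHardyNorm_congr (h : EqOn f g disc) : eHardyNorm p f = eHardyNorm p g :=
  biSup_congr fun _ hr => congrArg (eLpNorm · p circleMeasure) <|
    funext fun θ => h (circleMap_mem_disc_of_mem_Ioo hr θ)

lemma eHardyNorm_le_of_norm_le {M : ℝ} (hM : ∀ z ∈ disc, ‖f z‖ ≤ M) :
    eHardyNorm p f ≤ ENNReal.ofReal M :=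
  iSup₂_le fun r hr => by
    simpa using! eLpNorm_le_of_ae_bound (μ := circleMeasure) (p := p)
      (Eventually.of_forall fun θ => hM _ (circleMap_mem_disc_of_mem_Ioo hr θ))

lemma eHardyNorm_le_mul_of_norm_le_mul {k : ℂ → F} {M : ℝ}
    (hM : ∀ z ∈ disc, ‖f z‖ ≤ M * ‖k z‖) :
    eHardyNorm p f ≤ ENNReal.ofReal M * eHardyNorm p k :=
  iSup₂_le fun _ hr =>
    (eLpNorm_le_mul_eLpNorm_of_ae_le_mul
      (Eventually.of_forall fun θ => hM _ (circleMap_mem_disc_of_mem_Ioo hr θ)) p).trans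
      (by gcongr; exact integralMean_le_eHardyNorm hr)

lemma eHardyNorm_add_le (hp : 1 ≤ p) (hf : ContinuousOn f disc) (hg : ContinuousOn g disc) :
    eHardyNorm p (f + g) ≤ eHardyNorm p f + eHardyNorm p g :=
  iSup₂_le fun _ hr =>
    (eLpNorm_add_le (aestronglyMeasurable_comp_circleMap hf hr)
      (aestronglyMeasurable_comp_circleMap hg hr) hp).trans
      (add_le_add (integralMean_le_eHardyNorm hr) (integralMean_le_eHardyNorm hr))

lemma eHardyNorm_mono_exponent (hpq : p ≤ q) (hf : ContinuousOn f disc) :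
    eHardyNorm p f ≤ eHardyNorm q f :=
  iSup₂_mono fun _ hr =>
    eLpNorm_le_eLpNorm_of_exponent_le hpq (aestronglyMeasurable_comp_circleMap hf hr)

end eHardyNorm

section Hardy

variable {p : ℝ} {f h : ℂ → ℂ}

lemma integralMean_ofReal_rpow (hp : 0 < p) (f : ℂ → ℂ) (r : ℝ) :
    integralMean (ENNReal.ofReal p) f r ^ p = circleMean (fun z => ‖f z‖ₑ ^ p) r := by
  rw [integralMean, eLpNorm_eq_lintegral_rpow_enorm_toReal (by simpa using hp)
    ENNReal.ofReal_ne_top, ENNReal.toReal_ofReal hp.le, ← ENNReal.rpow_mul,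
    one_div_mul_cancel hp.ne', ENNReal.rpow_one, circleMean_eq_lintegral]

lemma hardySup_eq_eHardyNorm_rpow (hp : 0 < p) (f : ℂ → ℂ) :
    hardySup p f = eHardyNorm (ENNReal.ofReal p) f ^ p := by
  simp only [eHardyNorm, hardySup, ← integralMean_ofReal_rpow hp]
  exact ((ENNReal.orderIsoRpow p hp).map_iSup₂ _).symm

lemma hardyNorm_eq_toReal_eHardyNorm (hp : 0 < p) (f : ℂ → ℂ) :
    hardyNorm p f = (eHardyNorm (ENNReal.ofReal p) f).toReal := by
  rw [hardyNorm, hardySup_eq_eHardyNorm_rpow hp, ENNReal.toReal_rpow, ← ENNReal.rpow_mul,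
    mul_one_div_cancel hp.ne', ENNReal.rpow_one]

lemma mem_Hardy_iff (hp : 0 < p) :
    f ∈ Hardy p ↔ DifferentiableOn ℂ f disc ∧ eHardyNorm (ENNReal.ofReal p) f < ∞ := by
  rw [Hardy, mem_ofPred_eq, hardySup_eq_eHardyNorm_rpow hp, ENNReal.rpow_lt_top_iff_of_pos hp]

lemma hardyNorm_nonneg (p : ℝ) (f : ℂ → ℂ) : 0 ≤ hardyNorm p f :=
  Real.rpow_nonneg ENNReal.toReal_nonneg _

lemma eHardyNorm_eq_ofReal_hardyNorm (hp : 0 < p) (hf : f ∈ Hardy p) :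
    eHardyNorm (ENNReal.ofReal p) f = ENNReal.ofReal (hardyNorm p f) := by
  rw [hardyNorm_eq_toReal_eHardyNorm hp, ENNReal.ofReal_toReal ((mem_Hardy_iff hp).1 hf).2.ne]

lemma hardyNorm_le_of_eHardyNorm_le (hp : 0 < p) {K : ℝ} (hK : 0 ≤ K)
    (h : eHardyNorm (ENNReal.ofReal p) f ≤ ENNReal.ofReal K) : hardyNorm p f ≤ K := by
  rw [hardyNorm_eq_toReal_eHardyNorm hp]
  exact ENNReal.toReal_le_of_le_ofReal hK h

lemma eHardyNorm_one_le_ofReal_hardyNorm (hp : 1 ≤ p) (hf : f ∈ Hardy p) :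
    eHardyNorm 1 f ≤ ENNReal.ofReal (hardyNorm p f) :=
  (eHardyNorm_mono_exponent (by simpa using hp) hf.1.continuousOn).trans_eq
    (eHardyNorm_eq_ofReal_hardyNorm (one_pos.trans_le hp) hf)

lemma eHardyNorm_mulOp_le {q : ℝ≥0∞} {M : ℝ} (hM : ∀ z ∈ disc, ‖h z‖ ≤ M) (f : ℂ → ℂ) :
    eHardyNorm q (mulOp h f) ≤ ENNReal.ofReal M * eHardyNorm q f :=
  eHardyNorm_le_mul_of_norm_le_mul fun z hz =>
    (norm_mul_le _ _).trans (mul_le_mul_of_nonneg_right (hM z hz) (norm_nonneg _))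

lemma isBoundedOp_Hardy_mulOp_of_norm_le (hp : 0 < p) {M : ℝ} (hh : DifferentiableOn ℂ h disc)
    (hM : ∀ z ∈ disc, ‖h z‖ ≤ M) : IsBoundedOp (Hardy p) (hardyNorm p) (mulOp h) := by
  have hM0 : 0 ≤ M := (norm_nonneg _).trans (hM 0 zero_mem_disc)
  have hle : ∀ f ∈ Hardy p, eHardyNorm (ENNReal.ofReal p) (mulOp h f) ≤
      ENNReal.ofReal (M * hardyNorm p f) := fun f hf => by
    rw [ENNReal.ofReal_mul hM0, ← eHardyNorm_eq_ofReal_hardyNorm hp hf]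
    exact eHardyNorm_mulOp_le hM f
  exact ⟨fun f hf => (mem_Hardy_iff hp).2 ⟨hh.mul hf.1, (hle f hf).trans_lt ENNReal.ofReal_lt_top⟩,
    M, fun f hf => hardyNorm_le_of_eHardyNorm_le hp (mul_nonneg hM0 (hardyNorm_nonneg p f))
      (hle f hf)⟩

end Hardy

section DerivInHardyOne

variable [NormedSpace ℂ E] {g : ℂ → E}

lemma enorm_circleMap_sub_le_integralMean_deriv [CompleteSpace E]
    (hg : DifferentiableOn ℂ g disc) {r s t : ℝ} (hr : r ∈ Ioo (0 : ℝ) 1) (hs : 0 ≤ s)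
    (hst : s ≤ t) (ht : t ≤ 2 * π) :
    ‖g (circleMap 0 r t) - g (circleMap 0 r s)‖ₑ ≤
      ENNReal.ofReal (2 * π) * integralMean 1 (deriv g) r := by
  have hmem := circleMap_mem_disc_of_mem_Ioo hr
  have hcontDiff : ContDiff ℝ 1 fun θ => g (circleMap 0 r θ) :=
    (((hg.contDiffOn isOpen_disc).restrict_scalars ℝ).comp_contDiff
      (contDiff_circleMap 0 r) hmem)
  have henorm_deriv_le (θ : ℝ) :
      ‖deriv (fun θ => g (circleMap 0 r θ)) θ‖ₑ ≤ ‖deriv g (circleMap 0 r θ)‖ₑ := by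
    have hderiv := (hasDerivAt_of_mem_disc hg (hmem θ)).scomp θ (hasDerivAt_circleMap 0 r θ)
    rw [enorm_le_iff_norm_le]
    refine hderiv.deriv ▸ ?_
    rw [norm_smul, norm_mul, Complex.norm_I, mul_one]
    exact mul_le_of_le_one_left (norm_nonneg _) (mem_disc.1 (hmem θ)).le
  calc ‖g (circleMap 0 r t) - g (circleMap 0 r s)‖ₑ
      ≤ ∫⁻ θ in Icc s t, ‖deriv (fun θ => g (circleMap 0 r θ)) θ‖ₑ :=
        enorm_sub_le_lintegral_deriv_of_contDiffOn_Icc hcontDiff.contDiffOn hst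
    _ ≤ ∫⁻ θ in Icc s t, ‖deriv g (circleMap 0 r θ)‖ₑ := lintegral_mono henorm_deriv_le
    _ ≤ ∫⁻ θ in Icc 0 (2 * π), ‖deriv g (circleMap 0 r θ)‖ₑ :=
        lintegral_mono_set (Icc_subset_Icc hs ht)
    _ = ENNReal.ofReal (2 * π) * integralMean 1 (deriv g) r := by
        rw [← restrict_Ioc_eq_restrict_Icc, setLIntegral_Ioc_eq_mul_lintegral_circleMeasure,
          integralMean_one]

lemma enorm_sub_le_integralMean_deriv_of_mem_sphere [CompleteSpace E]
    (hg : DifferentiableOn ℂ g disc) {r : ℝ} (hr : r ∈ Ioo (0 : ℝ) 1) {z w : ℂ}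
    (hz : z ∈ Metric.sphere 0 r) (hw : w ∈ Metric.sphere 0 r) :
    ‖g w - g z‖ₑ ≤ ENNReal.ofReal (2 * π) * integralMean 1 (deriv g) r := by
  rw [← abs_of_pos hr.1, ← image_circleMap_Ioc] at hz hw
  obtain ⟨s, hs, rfl⟩ := hz
  obtain ⟨t, ht, rfl⟩ := hw
  rcases le_total s t with hst | hts
  · exact enorm_circleMap_sub_le_integralMean_deriv hg hr hs.1.le hst ht.2
  · rw [enorm_sub_rev]
    exact enorm_circleMap_sub_le_integralMean_deriv hg hr ht.1.le hts hs.2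

/-- The maximum principle for `w ↦ g w - g z` on `|w| < |z|` carries the oscillation bound on the
circle through `z` over to the centre. -/
lemma enorm_sub_zero_le_eHardyNorm_deriv [CompleteSpace E] (hg : DifferentiableOn ℂ g disc)
    {z : ℂ} (hz : z ∈ disc) :
    ‖g z - g 0‖ₑ ≤ ENNReal.ofReal (2 * π) * eHardyNorm 1 (deriv g) := by
  rcases eq_or_ne z 0 with rfl | hz0
  · simp
  have hr : ‖z‖ ∈ Ioo (0 : ℝ) 1 := ⟨norm_pos_iff.2 hz0, mem_disc.1 hz⟩
  have hclosure : closure (Metric.ball (0 : ℂ) ‖z‖) ⊆ disc :=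
    (closure_ball (0 : ℂ) hr.1.ne').trans_subset (Metric.closedBall_subset_ball hr.2)
  obtain ⟨w, hw, hmax⟩ := Complex.exists_mem_frontier_isMaxOn_norm Metric.isBounded_ball
    (Metric.nonempty_ball.2 hr.1) ((hg.sub_const (g z)).mono hclosure).diffContOnCl
  rw [frontier_ball _ hr.1.ne'] at hw
  calc ‖g z - g 0‖ₑ = ‖g 0 - g z‖ₑ := enorm_sub_rev _ _
    _ ≤ ‖g w - g z‖ₑ :=
        enorm_le_iff_norm_le.2 (hmax (subset_closure (Metric.mem_ball_self hr.1)))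
    _ ≤ ENNReal.ofReal (2 * π) * integralMean 1 (deriv g) ‖z‖ :=
        enorm_sub_le_integralMean_deriv_of_mem_sphere hg hr (mem_sphere_zero_iff_norm.2 rfl) hw
    _ ≤ ENNReal.ofReal (2 * π) * eHardyNorm 1 (deriv g) := by
        gcongr
        exact integralMean_le_eHardyNorm hr

lemma enorm_le_add_eHardyNorm_deriv [CompleteSpace E] (hg : DifferentiableOn ℂ g disc) {z : ℂ}
    (hz : z ∈ disc) : ‖g z‖ₑ ≤ ‖g 0‖ₑ + ENNReal.ofReal (2 * π) * eHardyNorm 1 (deriv g) := by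
  calc ‖g z‖ₑ = ‖g 0 + (g z - g 0)‖ₑ := by rw [add_sub_cancel]
    _ ≤ ‖g 0‖ₑ + ‖g z - g 0‖ₑ := enorm_add_le _ _
    _ ≤ _ := by gcongr; exact enorm_sub_zero_le_eHardyNorm_deriv hg hz

end DerivInHardyOne

section RadialLimits

lemma aemeasurable_enorm_comp_circleMap_prod {f : ℂ → E} (hf : ContinuousOn f disc) :
    AEMeasurable (fun q : ℝ × ℝ => ‖f (circleMap 0 q.2 q.1)‖ₑ)
      (circleMeasure.prod (volume.restrict (Ioo 0 1))) := by
  have hcont : ContinuousOn (fun q : ℝ × ℝ => f (circleMap 0 q.2 q.1)) (univ ×ˢ Ioo 0 1) :=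
    hf.comp (by unfold circleMap; fun_prop) fun q hq => circleMap_mem_disc_of_mem_Ioo hq.2 q.1
  rw [← Measure.restrict_univ (μ := circleMeasure), Measure.prod_restrict]
  exact (hcont.aestronglyMeasurable (MeasurableSet.univ.prod measurableSet_Ioo)).enorm

lemma lintegral_lintegral_radius_le_eHardyNorm {f : ℂ → E} (hf : ContinuousOn f disc) :
    ∫⁻ θ, (∫⁻ r in Ioo 0 1, ‖f (circleMap 0 r θ)‖ₑ) ∂circleMeasure ≤ eHardyNorm 1 f := by
  calc _ = ∫⁻ r in Ioo 0 1, integralMean 1 f r := by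
        rw [lintegral_lintegral_swap (aemeasurable_enorm_comp_circleMap_prod hf)]
        simp only [integralMean_one]
    _ ≤ ∫⁻ _ in Ioo (0 : ℝ) 1, eHardyNorm 1 f :=
        setLIntegral_mono measurable_const fun r hr => integralMean_le_eHardyNorm hr
    _ = eHardyNorm 1 f := by simp

lemma ae_integrableOn_radius {f : ℂ → E} (hf : ContinuousOn f disc) (hfin : eHardyNorm 1 f < ∞) :
    ∀ᵐ θ ∂circleMeasure, IntegrableOn (fun r => f (circleMap 0 r θ)) (Ioo 0 1) := by
  filter_upwards [ae_lt_top' (aemeasurable_enorm_comp_circleMap_prod hf).lintegral_prod_right'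
    ((lintegral_lintegral_radius_le_eHardyNorm hf).trans_lt hfin).ne] with θ hθ
  have hcont : ContinuousOn (fun r => f (circleMap 0 r θ)) (Ioo 0 1) :=
    hf.comp (by unfold circleMap; fun_prop) fun r hr => circleMap_mem_disc_of_mem_Ioo hr θ
  exact ⟨hcont.aestronglyMeasurable measurableSet_Ioo, hθ⟩

lemma exists_tendsto_nhdsLT_of_integrableOn_deriv [NormedSpace ℝ E] [CompleteSpace E]
    {φ φ' : ℝ → E} {a b : ℝ} (hab : a < b) (hderiv : ∀ x ∈ Ioo a b, HasDerivAt φ (φ' x) x)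
    (hint : IntegrableOn φ' (Ioo a b)) : ∃ l, Tendsto φ (𝓝[<] b) (𝓝 l) := by
  obtain ⟨c, hac, hcb⟩ := exists_between hab
  have hint_uIcc : IntegrableOn φ' (uIcc c b) := by
    rw [uIcc_of_le hcb.le, integrableOn_Icc_iff_integrableOn_Ioo]
    exact hint.mono_set (Ioo_subset_Ioo_left hac.le)
  have hprimitive : Tendsto (fun x => ∫ y in c..x, φ' y) (𝓝[<] b) (𝓝 (∫ y in c..b, φ' y)) := by
    have hcont := intervalIntegral.continuousOn_primitive_interval hint_uIcc b right_mem_uIcc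
    rw [uIcc_of_le hcb.le] at hcont
    rw [← nhdsWithin_Ioo_eq_nhdsLT hcb]
    exact hcont.tendsto.mono_left (nhdsWithin_mono b Ioo_subset_Icc_self)
  refine ⟨_, (hprimitive.const_add (φ c)).congr' ?_⟩
  filter_upwards [Ioo_mem_nhdsLT hcb] with x hx
  have hsub : uIcc c x ⊆ Ioo a b := by
    rw [uIcc_of_le hx.1.le]
    exact Icc_subset_Ioo hac hx.2
  rw [intervalIntegral.integral_eq_sub_of_hasDerivAt (fun y hy => hderiv y (hsub hy))
    (hint.mono_set hsub).intervalIntegrable, add_sub_cancel]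

lemma ae_exists_tendsto_radial [NormedSpace ℂ E] [CompleteSpace E] {g : ℂ → E}
    (hg : DifferentiableOn ℂ g disc) (hg' : eHardyNorm 1 (deriv g) < ∞) :
    ∀ᵐ θ ∂circleMeasure, ∃ l, Tendsto (fun r : ℝ => g (r * circleMap 0 1 θ)) (𝓝[<] 1) (𝓝 l) := by
  filter_upwards [ae_integrableOn_radius (hg.deriv isOpen_disc).continuousOn hg'] with θ hint
  refine exists_tendsto_nhdsLT_of_integrableOn_deriv
    (φ' := fun r => circleMap 0 1 θ • deriv g (circleMap 0 r θ)) zero_lt_one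
    (fun r hr => ?_) (hint.smul (circleMap 0 1 θ))
  have hray : HasDerivAt (fun r : ℝ => (r : ℂ) * circleMap 0 1 θ) (circleMap 0 1 θ) r := by
    simpa using (Complex.ofRealCLM.hasDerivAt (x := r)).mul_const (circleMap 0 1 θ)
  have hg_at : HasDerivAt g (deriv g (circleMap 0 r θ)) (r * circleMap 0 1 θ) := by
    rw [ofReal_mul_circleMap_one]
    exact hasDerivAt_of_mem_disc hg (circleMap_mem_disc_of_mem_Ioo hr θ)
  exact hg_at.scomp r hray

end RadialLimits

section Poisson

lemma circleMean_ofReal {u : ℂ → ℝ} {r : ℝ} (hu : CircleIntegrable u 0 r) (hu0 : ∀ z, 0 ≤ u z) :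
    circleMean (fun z => ENNReal.ofReal (u z)) r =
      ENNReal.ofReal (Real.circleAverage u 0 r) := by
  rw [circleMean, ← ofReal_integral_eq_lintegral_ofReal
    ((intervalIntegrable_iff_integrableOn_Ioc_of_le Real.two_pi_pos.le).1 hu)
    (Eventually.of_forall fun θ => hu0 _), ← ENNReal.ofReal_inv_of_pos Real.two_pi_pos,
    ← ENNReal.ofReal_mul (inv_nonneg.2 Real.two_pi_pos.le), Real.circleAverage_def,
    intervalIntegral.integral_of_le Real.two_pi_pos.le, smul_eq_mul]

lemma norm_one_sub_conj_mul {a w : ℂ} (hw : ‖w‖ = 1) :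
    ‖1 - (starRingEnd ℂ) a * w‖ = ‖w - a‖ := by
  have hfactor : 1 - (starRingEnd ℂ) a * w = w * (starRingEnd ℂ) (w - a) := by
    rw [map_sub, mul_sub, Complex.mul_conj', hw]
    push_cast
    ring
  rw [hfactor, norm_mul, hw, one_mul, RCLike.norm_conj]

lemma div_norm_one_sub_conj_mul_eq_poissonKernel (a : ℂ) {w : ℂ} (hw : ‖w‖ = 1) :
    (1 - ‖a‖ ^ 2) / ‖1 - (starRingEnd ℂ) a * w‖ ^ 2 = poissonKernel 0 a w := by
  rw [norm_one_sub_conj_mul hw, poissonKernel_def, sub_zero, sub_zero, hw, one_pow]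

lemma circleAverage_poissonKernel {a : ℂ} (ha : a ∈ disc) :
    Real.circleAverage (poissonKernel 0 a) 0 1 = 1 := by
  have h := InnerProductSpace.HarmonicContOnCl.circleAverage_poissonKernel_smul
    (InnerProductSpace.harmonicContOnCl_const (c := (1 : ℝ))) ha
  rwa [show (poissonKernel 0 a • fun _ => (1 : ℝ)) = poissonKernel 0 a from
    funext fun _ => mul_one _] at h

lemma circleMean_poisson {a : ℂ} (ha : a ∈ disc) :
    circleMean (fun w => ENNReal.ofReal
      ((1 - ‖a‖ ^ 2) / ‖1 - (starRingEnd ℂ) a * w‖ ^ 2)) 1 = 1 := by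
  have ha1 : ‖a‖ < 1 := mem_disc.1 ha
  have hdenom : ∀ w ∈ Metric.sphere (0 : ℂ) 1, ‖1 - (starRingEnd ℂ) a * w‖ ^ 2 ≠ 0 := by
    intro w hw
    rw [mem_sphere_zero_iff_norm] at hw
    rw [norm_one_sub_conj_mul hw]
    exact pow_ne_zero 2 (norm_ne_zero_iff.2 (sub_ne_zero.2 (by rintro rfl; exact ha1.ne hw)))
  have hcont : ContinuousOn
      (fun w => (1 - ‖a‖ ^ 2) / ‖1 - (starRingEnd ℂ) a * w‖ ^ 2) (Metric.sphere (0 : ℂ) 1) :=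
    continuousOn_const.div (by fun_prop) hdenom
  have hnonneg (w : ℂ) : 0 ≤ (1 - ‖a‖ ^ 2) / ‖1 - (starRingEnd ℂ) a * w‖ ^ 2 :=
    div_nonneg (sub_nonneg.2 (pow_le_one₀ (norm_nonneg a) ha1.le)) (sq_nonneg _)
  rw [circleMean_ofReal (hcont.circleIntegrable zero_le_one) hnonneg,
    Real.circleAverage_congr_sphere fun w hw =>
      div_norm_one_sub_conj_mul_eq_poissonKernel a (by simpa using hw),
    circleAverage_poissonKernel ha, ENNReal.ofReal_one]

lemma poissonSup_le_of_ae_enorm_boundaryValue_le {p : ℝ} (hp : 0 ≤ p) {f : ℂ → ℂ} {M : ℝ≥0∞}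
    (hM : ∀ᵐ θ ∂circleMeasure, ‖boundaryValue f (circleMap 0 1 θ)‖ₑ ≤ M) :
    poissonSup p f ≤ M ^ p := by
  refine iSup₂_le fun a ha => ?_
  calc _ ≤ ∫⁻ θ, ENNReal.ofReal
          ((1 - ‖a‖ ^ 2) / ‖1 - (starRingEnd ℂ) a * circleMap 0 1 θ‖ ^ 2) *
          M ^ p ∂circleMeasure := by
        rw [circleMean_eq_lintegral]
        refine lintegral_mono_ae ?_
        filter_upwards [hM] with θ hθ
        gcongr
    _ = circleMean (fun w => ENNReal.ofReal
          ((1 - ‖a‖ ^ 2) / ‖1 - (starRingEnd ℂ) a * w‖ ^ 2)) 1 * M ^ p := by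
        rw [lintegral_mul_const _ (by fun_prop), circleMean_eq_lintegral]
    _ = M ^ p := by rw [circleMean_poisson ha, one_mul]

lemma enorm_boundaryValue_le {f : ℂ → ℂ} {M : ℝ≥0∞} (hM : ∀ z ∈ disc, ‖f z‖ₑ ≤ M) {w : ℂ}
    (hw : ‖w‖ = 1) (hlim : ∃ l, Tendsto (fun r : ℝ => f (r * w)) (𝓝[<] 1) (𝓝 l)) :
    ‖boundaryValue f w‖ₑ ≤ M := by
  refine le_of_tendsto (tendsto_nhds_limUnder hlim).enorm ?_
  filter_upwards [Ioo_mem_nhdsLT (zero_lt_one (α := ℝ))] with r hr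
  exact hM _ (by simp [mem_disc, hw, abs_of_pos hr.1, hr.2])

lemma poissonSup_lt_top_of_eHardyNorm_deriv_lt_top {p : ℝ} (hp : 0 ≤ p) {g : ℂ → ℂ}
    (hg : DifferentiableOn ℂ g disc) (hg' : eHardyNorm 1 (deriv g) < ∞) :
    poissonSup p g < ∞ := by
  set M : ℝ≥0∞ := ‖g 0‖ₑ + ENNReal.ofReal (2 * π) * eHardyNorm 1 (deriv g)
  have hM : M ≠ ∞ :=
    ENNReal.add_ne_top.2 ⟨enorm_ne_top, ENNReal.mul_ne_top ENNReal.ofReal_ne_top hg'.ne⟩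
  refine (poissonSup_le_of_ae_enorm_boundaryValue_le hp (M := M) ?_).trans_lt
    (ENNReal.rpow_lt_top_of_nonneg hp hM)
  filter_upwards [ae_exists_tendsto_radial hg hg'] with θ hθ
  exact enorm_boundaryValue_le (fun z hz => enorm_le_add_eHardyNorm_deriv hg hz) (by simp) hθ

end Poisson

section S2

variable {p : ℝ} {f ψ : ℂ → ℂ}

lemma S2Norm_nonneg (p : ℝ) (f : ℂ → ℂ) : 0 ≤ S2Norm p f :=
  add_nonneg (by positivity) (hardyNorm_nonneg _ _)

lemma norm_deriv_le_of_mem_S2 (hp : 1 ≤ p) (hf : f ∈ S2 p) {z : ℂ} (hz : z ∈ disc) :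
    ‖deriv f z‖ ≤ ‖deriv f 0‖ + 2 * π * hardyNorm p (deriv (deriv f)) := by
  have hnonneg : 0 ≤ 2 * π * hardyNorm p (deriv (deriv f)) :=
    mul_nonneg Real.two_pi_pos.le (hardyNorm_nonneg _ _)
  rw [← ENNReal.ofReal_le_ofReal_iff (by positivity), ofReal_norm,
    ENNReal.ofReal_add (norm_nonneg _) hnonneg, ofReal_norm,
    ENNReal.ofReal_mul Real.two_pi_pos.le]
  refine (enorm_le_add_eHardyNorm_deriv (hf.1.deriv isOpen_disc) hz).trans ?_
  gcongr
  exact eHardyNorm_one_le_ofReal_hardyNorm hp hf.2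

lemma norm_deriv_le_S2Norm (hp : 1 ≤ p) (hf : f ∈ S2 p) {z : ℂ} (hz : z ∈ disc) :
    ‖deriv f z‖ ≤ 2 * π * S2Norm p f := by
  have hpi : 1 ≤ 2 * π := by linarith [Real.pi_gt_three]
  calc ‖deriv f z‖ ≤ ‖deriv f 0‖ + 2 * π * hardyNorm p (deriv (deriv f)) :=
        norm_deriv_le_of_mem_S2 hp hf hz
    _ ≤ 2 * π * S2Norm p f := by
        simp only [S2Norm]
        linarith [mul_nonneg Real.two_pi_pos.le (norm_nonneg (f 0)),
          le_mul_of_one_le_left (norm_nonneg (deriv f 0)) hpi]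

lemma norm_le_S2Norm (hp : 1 ≤ p) (hf : f ∈ S2 p) {z : ℂ} (hz : z ∈ disc) :
    ‖f z‖ ≤ 2 * π * S2Norm p f := by
  have hpi : 1 ≤ 2 * π := by linarith [Real.pi_gt_three]
  set D := ‖deriv f 0‖ + 2 * π * hardyNorm p (deriv (deriv f))
  have hmean : ‖f z - f 0‖ ≤ D * ‖z - 0‖ :=
    (convex_ball 0 1).norm_image_sub_le_of_norm_deriv_le
      (fun x hx => (hasDerivAt_of_mem_disc hf.1 hx).differentiableAt)
      (fun x hx => norm_deriv_le_of_mem_S2 hp hf hx) zero_mem_disc hz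
  have hD : 0 ≤ D := (norm_nonneg _).trans (norm_deriv_le_of_mem_S2 hp hf hz)
  calc ‖f z‖ ≤ ‖f 0‖ + ‖f z - f 0‖ := norm_le_norm_add_norm_sub' _ _
    _ ≤ ‖f 0‖ + D := by
        gcongr
        rw [sub_zero] at hmean
        exact hmean.trans (mul_le_of_le_one_right hD (mem_disc.1 hz).le)
    _ ≤ 2 * π * S2Norm p f := by
        simp only [D, S2Norm]
        linarith [le_mul_of_one_le_left (norm_nonneg (f 0)) hpi,
          le_mul_of_one_le_left (norm_nonneg (deriv f 0)) hpi]

lemma eHardyNorm_deriv_le_S2Norm (hp : 1 ≤ p) (hf : f ∈ S2 p) (q : ℝ≥0∞) :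
    eHardyNorm q (deriv f) ≤ ENNReal.ofReal (2 * π * S2Norm p f) :=
  eHardyNorm_le_of_norm_le fun _ hz => norm_deriv_le_S2Norm hp hf hz

lemma eHardyNorm_deriv_deriv_le_S2Norm (hp : 0 < p) (hf : f ∈ S2 p) :
    eHardyNorm (ENNReal.ofReal p) (deriv (deriv f)) ≤ ENNReal.ofReal (S2Norm p f) := by
  rw [eHardyNorm_eq_ofReal_hardyNorm hp hf.2]
  exact ENNReal.ofReal_le_ofReal (le_add_of_nonneg_left (by positivity))

lemma norm_two_mul_deriv_le_S2Norm (hp : 1 ≤ p) (hψ : ψ ∈ S2 p) {z : ℂ} (hz : z ∈ disc) :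
    ‖2 * deriv ψ z‖ ≤ 4 * π * S2Norm p ψ := by
  rw [norm_mul, Complex.norm_two]
  linarith [norm_deriv_le_S2Norm hp hψ hz]

lemma deriv_mulOp (hψ : DifferentiableOn ℂ ψ disc) (hf : DifferentiableOn ℂ f disc) :
    EqOn (deriv (mulOp ψ f)) (mulOp (deriv ψ) f + mulOp ψ (deriv f)) disc := fun _ hz =>
  ((hasDerivAt_of_mem_disc hψ hz).mul (hasDerivAt_of_mem_disc hf hz)).deriv

lemma deriv_deriv_mulOp (hψ : DifferentiableOn ℂ ψ disc) (hf : DifferentiableOn ℂ f disc) :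
    EqOn (deriv (deriv (mulOp ψ f)))
      (mulOp f (deriv (deriv ψ)) + mulOp (fun z => 2 * deriv ψ z) (deriv f) +
        mulOp ψ (deriv (deriv f))) disc := by
  intro z hz
  have hψ' := hψ.deriv isOpen_disc
  have hf' := hf.deriv isOpen_disc
  have hsum : HasDerivAt (mulOp (deriv ψ) f + mulOp ψ (deriv f)) _ z :=
    ((hasDerivAt_of_mem_disc hψ' hz).mul (hasDerivAt_of_mem_disc hf hz)).add
      ((hasDerivAt_of_mem_disc hψ hz).mul (hasDerivAt_of_mem_disc hf' hz))
  rw [((deriv_mulOp hψ hf).eventuallyEq_of_mem (isOpen_disc.mem_nhds hz)).deriv_eq, hsum.deriv]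
  simp only [mulOp, Pi.add_apply]
  ring

lemma eHardyNorm_deriv_deriv_mulOp_le (hp : 1 ≤ p) (hψ : ψ ∈ S2 p) (hf : f ∈ S2 p) :
    eHardyNorm (ENNReal.ofReal p) (deriv (deriv (mulOp ψ f))) ≤
      ENNReal.ofReal ((4 * π + 8 * π ^ 2) * (S2Norm p ψ * S2Norm p f)) := by
  have hp0 : 0 < p := one_pos.trans_le hp
  have hp1 : 1 ≤ ENNReal.ofReal p := by simpa using hp
  have hNψ := S2Norm_nonneg p ψ
  have hNf := S2Norm_nonneg p f
  have hψ' : DifferentiableOn ℂ (fun z => 2 * deriv ψ z) disc :=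
    (hψ.1.deriv isOpen_disc).const_mul 2
  have hc₁ := (hf.1.mul hψ.2.1).continuousOn
  have hc₂ := (hψ'.mul (hf.1.deriv isOpen_disc)).continuousOn
  have hc₃ := (hψ.1.mul hf.2.1).continuousOn
  rw [eHardyNorm_congr (deriv_deriv_mulOp hψ.1 hf.1)]
  calc _ ≤ _ := eHardyNorm_add_le hp1 (hc₁.add hc₂) hc₃
    _ ≤ _ := add_le_add_left (eHardyNorm_add_le hp1 hc₁ hc₂) _
    _ ≤ ENNReal.ofReal (2 * π * S2Norm p f) * ENNReal.ofReal (S2Norm p ψ) +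
        ENNReal.ofReal (4 * π * S2Norm p ψ) * ENNReal.ofReal (2 * π * S2Norm p f) +
        ENNReal.ofReal (2 * π * S2Norm p ψ) * ENNReal.ofReal (S2Norm p f) := by
      gcongr
      · exact (eHardyNorm_mulOp_le (fun z hz => norm_le_S2Norm hp hf hz) _).trans
          (by gcongr; exact eHardyNorm_deriv_deriv_le_S2Norm hp0 hψ)
      · exact (eHardyNorm_mulOp_le (fun z hz => norm_two_mul_deriv_le_S2Norm hp hψ hz) _).trans
          (by gcongr; exact eHardyNorm_deriv_le_S2Norm hp hf _)
      · exact (eHardyNorm_mulOp_le (fun z hz => norm_le_S2Norm hp hψ hz) _).trans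
          (by gcongr; exact eHardyNorm_deriv_deriv_le_S2Norm hp0 hf)
    _ = _ := by
      rw [← ENNReal.ofReal_mul (by positivity), ← ENNReal.ofReal_mul (by positivity),
        ← ENNReal.ofReal_mul (by positivity), ← ENNReal.ofReal_add (by positivity) (by positivity),
        ← ENNReal.ofReal_add (by positivity) (by positivity)]
      congr 1
      ring

lemma mulOp_mem_S2 (hp : 1 ≤ p) (hψ : ψ ∈ S2 p) (hf : f ∈ S2 p) : mulOp ψ f ∈ S2 p := by
  have hdiff : DifferentiableOn ℂ (mulOp ψ f) disc := hψ.1.mul hf.1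
  exact ⟨hdiff, (mem_Hardy_iff (one_pos.trans_le hp)).2
    ⟨(hdiff.deriv isOpen_disc).deriv isOpen_disc,
      (eHardyNorm_deriv_deriv_mulOp_le hp hψ hf).trans_lt ENNReal.ofReal_lt_top⟩⟩

lemma norm_mulOp_zero_add_norm_deriv_mulOp_zero_le (hψ : ψ ∈ S2 p) (hf : f ∈ S2 p) :
    ‖mulOp ψ f 0‖ + ‖deriv (mulOp ψ f) 0‖ ≤ S2Norm p ψ * S2Norm p f := by
  have hψ'' := hardyNorm_nonneg p (deriv (deriv ψ))
  have hf'' := hardyNorm_nonneg p (deriv (deriv f))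
  calc ‖mulOp ψ f 0‖ + ‖deriv (mulOp ψ f) 0‖
      ≤ ‖ψ 0‖ * ‖f 0‖ + (‖deriv ψ 0‖ * ‖f 0‖ + ‖ψ 0‖ * ‖deriv f 0‖) := by
        rw [deriv_mulOp hψ.1 hf.1 zero_mem_disc]
        gcongr
        · exact norm_mul_le _ _
        · exact (norm_add_le _ _).trans (add_le_add (norm_mul_le _ _) (norm_mul_le _ _))
    _ ≤ (‖ψ 0‖ + ‖deriv ψ 0‖) * (‖f 0‖ + ‖deriv f 0‖) := by
        linarith [mul_nonneg (norm_nonneg (deriv ψ 0)) (norm_nonneg (deriv f 0))]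
    _ ≤ S2Norm p ψ * S2Norm p f :=
        mul_le_mul (le_add_of_nonneg_right hψ'') (le_add_of_nonneg_right hf'') (by positivity)
          (S2Norm_nonneg p ψ)

lemma S2Norm_mulOp_le (hp : 1 ≤ p) (hψ : ψ ∈ S2 p) (hf : f ∈ S2 p) :
    S2Norm p (mulOp ψ f) ≤ (1 + 4 * π + 8 * π ^ 2) * (S2Norm p ψ * S2Norm p f) := by
  have hN := mul_nonneg (S2Norm_nonneg p ψ) (S2Norm_nonneg p f)
  have hhardy := hardyNorm_le_of_eHardyNorm_le (one_pos.trans_le hp) (by positivity)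
    (eHardyNorm_deriv_deriv_mulOp_le hp hψ hf)
  rw [S2Norm]
  linarith [norm_mulOp_zero_add_norm_deriv_mulOp_zero_le hψ hf]

lemma isBoundedOp_S2_mulOp (hp : 1 ≤ p) (hψ : ψ ∈ S2 p) :
    IsBoundedOp (S2 p) (S2Norm p) (mulOp ψ) :=
  ⟨fun _ hf => mulOp_mem_S2 hp hψ hf, (1 + 4 * π + 8 * π ^ 2) * S2Norm p ψ, fun _ hf =>
    (S2Norm_mulOp_le hp hψ hf).trans_eq (mul_assoc _ _ _).symm⟩

lemma one_mem_S2 (hp : 0 < p) : (1 : ℂ → ℂ) ∈ S2 p := by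
  refine ⟨differentiableOn_const 1, (mem_Hardy_iff hp).2 ?_⟩
  have hderiv : deriv (deriv (1 : ℂ → ℂ)) = 0 := by simp
  rw [hderiv]
  exact ⟨differentiableOn_const 0,
    (eHardyNorm_le_of_norm_le (M := 0) (by simp)).trans_lt ENNReal.ofReal_lt_top⟩

lemma mem_S2_of_isBoundedOp_mulOp (hp : 0 < p) (h : IsBoundedOp (S2 p) (S2Norm p) (mulOp ψ)) :
    ψ ∈ S2 p := by
  have hone : mulOp ψ 1 = ψ := funext fun z => mul_one (ψ z)
  exact hone ▸ h.1 1 (one_mem_S2 hp)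

lemma poissonSup_two_mul_deriv_lt_top (hp : 1 ≤ p) (hψ : ψ ∈ S2 p) :
    poissonSup p (fun z => 2 * deriv ψ z) < ∞ := by
  refine poissonSup_lt_top_of_eHardyNorm_deriv_lt_top (by linarith)
    ((hψ.1.deriv isOpen_disc).const_mul 2) ?_
  calc eHardyNorm 1 (deriv fun z => 2 * deriv ψ z)
      ≤ ENNReal.ofReal 2 * eHardyNorm 1 (deriv (deriv ψ)) :=
        eHardyNorm_le_mul_of_norm_le_mul fun z _ => by
          rw [deriv_const_mul_field, norm_mul, Complex.norm_two]
    _ < ∞ := ENNReal.mul_lt_top ENNReal.ofReal_lt_top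
        ((eHardyNorm_one_le_ofReal_hardyNorm hp hψ.2).trans_lt ENNReal.ofReal_lt_top)

lemma poissonSup_lt_top_of_mem_S2 (hp : 1 ≤ p) (hψ : ψ ∈ S2 p) : poissonSup p ψ < ∞ :=
  poissonSup_lt_top_of_eHardyNorm_deriv_lt_top (by linarith) hψ.1
    ((eHardyNorm_deriv_le_S2Norm hp hψ 1).trans_lt ENNReal.ofReal_lt_top)

end S2

end HardyMult

open HardyMult in
theorem mainTheorem4_general {p : ℝ} (hp : 1 ≤ p) (ψ : ℂ → ℂ) :
    List.TFAE [
      ψ ∈ S2 p,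
      IsBoundedOp (S2 p) (S2Norm p) (mulOp ψ),
      ψ ∈ S2 p ∧ IsBoundedOp (Hardy p) (hardyNorm p) (mulOp fun z => 2 * deriv ψ z) ∧
        IsBoundedOp (Hardy p) (hardyNorm p) (mulOp ψ),
      ψ ∈ S2 p ∧ poissonSup p (fun z => 2 * deriv ψ z) < ∞ ∧ poissonSup p ψ < ∞] := by
  have hp0 : 0 < p := one_pos.trans_le hp
  tfae_have 1 → 2 := isBoundedOp_S2_mulOp hp
  tfae_have 2 → 1 := mem_S2_of_isBoundedOp_mulOp hp0
  tfae_have 1 → 3 := fun hψ =>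
    ⟨hψ, isBoundedOp_Hardy_mulOp_of_norm_le hp0 ((hψ.1.deriv isOpen_disc).const_mul 2)
        fun _ hz => norm_two_mul_deriv_le_S2Norm hp hψ hz,
      isBoundedOp_Hardy_mulOp_of_norm_le hp0 hψ.1 fun _ hz => norm_le_S2Norm hp hψ hz⟩
  tfae_have 3 → 1 := And.left
  tfae_have 1 → 4 := fun hψ =>
    ⟨hψ, poissonSup_two_mul_deriv_lt_top hp hψ, poissonSup_lt_top_of_mem_S2 hp hψ⟩
  tfae_have 4 → 1 := And.left
  tfae_finish

theorem mainTheorem4 (p : ℝ) (hp : 1 ≤ p) (ψ : ℂ → ℂ)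
    (hψ : DifferentiableOn ℂ ψ HardyMult.disc) :
    List.TFAE [
      HardyMult.IsBoundedOp (HardyMult.S2 p) (HardyMult.S2Norm p) (HardyMult.mulOp ψ),
      ψ ∈ HardyMult.S2 p ∧
        HardyMult.IsBoundedOp (HardyMult.Hardy p) (HardyMult.hardyNorm p)
          (HardyMult.mulOp (fun z => 2 * deriv ψ z)) ∧
        HardyMult.IsBoundedOp (HardyMult.Hardy p) (HardyMult.hardyNorm p) (HardyMult.mulOp ψ),
      ψ ∈ HardyMult.S2 p ∧
        HardyMult.poissonSup p (fun z => 2 * deriv ψ z) < ⊤ ∧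
        HardyMult.poissonSup p ψ < ⊤] := by
  exact (List.tfae_cons_cons.1 (mainTheorem4_general hp ψ)).2
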